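/- Notation. Let $\mathbb S=\{q\in\mathbb H: q^2=-1\}$ be the sphere of imaginary units of the quaternions $\mathbb H$, and $\mathbb C_J=\mathbb R+J\mathbb R$ for $J\in\mathbb S$. Let $D\subset\mathbb C$ be a set symmetric with respect to the real axis and $\Omega_D=\{\alpha+I\beta:\alpha+i\beta\in D,\ I\in\mathbb S\}\subset\mathbb H$. A stem function on $D$ is a map $F=F_1+F_2\imath:D\to\mathbb H\otimes_{\mathbb R}\mathbb C$ (with $\imath=1\otimes i$) such that $F(\bar z)=\overline{F(z)}$, where $\overline{p+q\imath}=p-q\imath$. A function $f:\Omega_D\to\mathbb H$ is a slice function if there is a stem function $F$ on $D$ with $f(\alpha+I\beta)=F_1(\alpha+i\beta)+I\,F_2(\alpha+i\beta)$ for all $\alpha+i\beta\in D$, $I\in\mathbb S$; it is regular (anti-regular) if $F$ is holomorphic (anti-holomorphic), and slice-preserving if $f(\Omega_D\cap\mathbb C_J)\subset\mathbb C_J$ for all $J\in\mathbb S$. For $q\in\mathbb C_I$, $I\in\mathbb S$, put $$(\partial_*f)(q)=\tfrac12\big((\partial_1-I\partial_I)f\big)(q),\qquad(\bar\partial_*f)(q)=\tfrac12\big((\partial_1+I\partial_I)f\big)(q),\qquad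 \Delta_*=4\,\partial_*\bar\partial_*,$$ where $\partial_v$ is the directional derivative in the direction $v$. For a $C^2$ slice function $f$ induced by $F$ these do not depend on the choice of $I$, also at real points $q$, and $\partial_*f$, $\bar\partial_*f$, $\Delta_*f$ are the slice functions on $\Omega_D$ induced by $\partial F/\partial z$, $\partial F/\partial\bar z$ and $\Delta F$. Theorem. Let $D\subset\mathbb C$ be a simply connected domain that is symmetric with respect to the real axis and meets $\mathbb R$, and let $f:\Omega_D\to\mathbb H$ be a $C^2$ slice function. (1) $\Delta_*f$ vanishes identically on $\Omega_D$ if and only if $f=g+h$ on $\Omega_D$ with a regular function $g$ and an anti-regular function $h$ on $\Omega_D$. (2) Assume $\Delta_*f\equiv0$ and let $D_{\mathbb R}=D\cap\mathbb R$. Then the following are equivalent: (a) $f=g+h$ on $\Omega_D$ with a slice-preserving regular function $g$ and a slice-preserving anti-regular function $h$ on $\Omega_D$; (b) $f(x)\in\mathbb R$ and $(\partial_*f)(x)\in\mathbb R$ for all $x\in D_{\mathbb R}$; (c) $f(x)\in\mathbb R$ and $(\bar\partial_*f)(x)\in\mathbb R$ for all $x\in D_{\mathbb R}$; (d) there is $p\in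 D_{\mathbb R}$ with $f(p)\in\mathbb R$, and $(\bar\partial_*f)(x)\in\mathbb R$ and $(\partial_*f)(x)\in\mathbb R$ for all $x\in D_{\mathbb R}$. -/

import Mathlib

open scoped Quaternion

noncomputable section

namespace SliceFun

/-- The complexified quaternions `ℍ ⊗ ℂ = {p + q ι}`: the element `p + q ι` is the pair `(p, q)`. -/
abbrev HC : Type := ℍ[ℝ] × ℍ[ℝ]

/-- Multiplication by the imaginary unit of the factor `ℂ`: `ι (p + q ι) = -q + p ι`. -/
def iotaMul (w : HC) : HC := (-w.2, w.1)

/-- Complex conjugation on `ℍ ⊗ ℂ`: `p + q ι ↦ p - q ι`. -/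
def conjHC (w : HC) : HC := (w.1, -w.2)

/-- The sphere of quaternionic imaginary units. -/
def unitSphere : Set ℍ[ℝ] := {q | q ^ 2 = -1}

/-- The slice `ℂ_J = ℝ + J ℝ`. -/
def slice (J : ℍ[ℝ]) : Set ℍ[ℝ] := {q | ∃ a b : ℝ, q = (a : ℍ[ℝ]) + J * (b : ℍ[ℝ])}

/-- The circularization `Ω_D` of a set `D ⊆ ℂ`. -/
def circ (D : Set ℂ) : Set ℍ[ℝ] :=
  {q | ∃ z ∈ D, ∃ I ∈ unitSphere, q = (z.re : ℍ[ℝ]) + I * (z.im : ℍ[ℝ])}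

/-- `D` is symmetric with respect to the real axis. -/
def IsSymmetric (D : Set ℂ) : Prop := ∀ z ∈ D, (starRingEnd ℂ) z ∈ D

/-- `F` is a stem function on the symmetric set `D`. -/
def IsStemOn (F : ℂ → HC) (D : Set ℂ) : Prop :=
  ∀ z ∈ D, F ((starRingEnd ℂ) z) = conjHC (F z)

/-- `f` is the function on `Ω_D` induced by `F = F₁ + F₂ ι`: `f (α + I β) = F₁ (α + i β) + I F₂ (α + i β)`. -/
def Induces (F : ℂ → HC) (f : ℍ[ℝ] → ℍ[ℝ]) (D : Set ℂ) : Prop :=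
  ∀ z ∈ D, ∀ I ∈ unitSphere, f ((z.re : ℍ[ℝ]) + I * (z.im : ℍ[ℝ])) = (F z).1 + I * (F z).2

/-- `f` is a (left) slice function on `Ω_D`. -/
def IsSliceOn (f : ℍ[ℝ] → ℍ[ℝ]) (D : Set ℂ) : Prop :=
  ∃ F : ℂ → HC, IsStemOn F D ∧ Induces F f D

/-- `∂F/∂z = (∂F/∂α - ι ∂F/∂β) / 2`. -/
def dz (F : ℂ → HC) (z : ℂ) : HC :=
  (1 / 2 : ℝ) • (fderiv ℝ F z 1 - iotaMul (fderiv ℝ F z Complex.I))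

/-- `∂F/∂z̄ = (∂F/∂α + ι ∂F/∂β) / 2`. -/
def dzbar (F : ℂ → HC) (z : ℂ) : HC :=
  (1 / 2 : ℝ) • (fderiv ℝ F z 1 + iotaMul (fderiv ℝ F z Complex.I))

/-- `F` is holomorphic on `D` as a map to the complex vector space `ℍ ⊗ ℂ`. -/
def HolomorphicOn (F : ℂ → HC) (D : Set ℂ) : Prop :=
  (∀ z ∈ D, DifferentiableAt ℝ F z) ∧ ∀ z ∈ D, dzbar F z = 0

/-- `F` is anti-holomorphic on `D` as a map to the complex vector space `ℍ ⊗ ℂ`. -/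
def AntiHolomorphicOn (F : ℂ → HC) (D : Set ℂ) : Prop :=
  (∀ z ∈ D, DifferentiableAt ℝ F z) ∧ ∀ z ∈ D, dz F z = 0

/-- `f` is a (slice) regular function on `Ω_D`. -/
def IsRegularOn (f : ℍ[ℝ] → ℍ[ℝ]) (D : Set ℂ) : Prop :=
  ∃ F : ℂ → HC, IsStemOn F D ∧ Induces F f D ∧ HolomorphicOn F D

/-- `f` is an anti-regular function on `Ω_D`. -/
def IsAntiRegularOn (f : ℍ[ℝ] → ℍ[ℝ]) (D : Set ℂ) : Prop :=
  ∃ F : ℂ → HC, IsStemOn F D ∧ Induces F f D ∧ AntiHolomorphicOn F D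

/-- `f` maps `Ω_D ∩ ℂ_J` into `ℂ_J` for every imaginary unit `J`. -/
def IsSlicePreservingOn (f : ℍ[ℝ] → ℍ[ℝ]) (D : Set ℂ) : Prop :=
  ∀ J ∈ unitSphere, ∀ q ∈ circ D ∩ slice J, f q ∈ slice J

/-- The quaternion `i`. -/
def unitI : ℍ[ℝ] := ⟨0, 1, 0, 0⟩

open Classical in
/-- An imaginary unit `I` with `q ∈ ℂ_I`. Off the real axis it is `Im q / |Im q|`, the unit that is
determined by `q` up to sign; a real `q` lies on every slice, and there we take `I = i`. -/
def unitOf (q : ℍ[ℝ]) : ℍ[ℝ] :=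
  if q.im = 0 then unitI else (‖q.im‖⁻¹ : ℝ) • q.im

/-- `(∂₁ f - I ∂_I f)(q) / 2`, with the directional derivatives `∂₁`, `∂_I`. -/
def dI (I : ℍ[ℝ]) (f : ℍ[ℝ] → ℍ[ℝ]) (q : ℍ[ℝ]) : ℍ[ℝ] :=
  (1 / 2 : ℝ) • (lineDeriv ℝ f q 1 - I * lineDeriv ℝ f q I)

/-- `(∂₁ f + I ∂_I f)(q) / 2`, with the directional derivatives `∂₁`, `∂_I`. -/
def dbarI (I : ℍ[ℝ]) (f : ℍ[ℝ] → ℍ[ℝ]) (q : ℍ[ℝ]) : ℍ[ℝ] :=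
  (1 / 2 : ℝ) • (lineDeriv ℝ f q 1 + I * lineDeriv ℝ f q I)

/-- The operator `∂_*`. Its value does not depend on the unit `I` with `q ∈ ℂ_I`: off the real axis
replacing `I` by `-I` changes nothing, and at a real point of the domain of a slice function all
units give the same value. For slice functions, see `dStar_eq` below. -/
def dStar (f : ℍ[ℝ] → ℍ[ℝ]) (q : ℍ[ℝ]) : ℍ[ℝ] := dI (unitOf q) f q

/-- The operator `∂̄_*`; see `dbarStar_eq` below for slice functions. -/
def dbarStar (f : ℍ[ℝ] → ℍ[ℝ]) (q : ℍ[ℝ]) : ℍ[ℝ] := dbarI (unitOf q) f q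

/-- The Laplacian `Δ_* = 4 ∂_* ∂̄_*`. -/
def lapStar (f : ℍ[ℝ] → ℍ[ℝ]) (q : ℍ[ℝ]) : ℍ[ℝ] := 4 * dStar (dbarStar f) q

theorem sq_unit {J : ℍ[ℝ]} (hJ : J ∈ unitSphere) : J * J = -1 := by
  have h : J ^ 2 = -1 := hJ
  rwa [sq] at h

theorem neg_unit {J : ℍ[ℝ]} (hJ : J ∈ unitSphere) : -J ∈ unitSphere := by
  have h : J ^ 2 = -1 := hJ
  simpa [unitSphere] using h

theorem re_unit {J : ℍ[ℝ]} (hJ : J ∈ unitSphere) : J.re = 0 := by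
  have h := sq_unit hJ
  have h0 := congrArg QuaternionAlgebra.re h
  have h1 := congrArg QuaternionAlgebra.imI h
  have h2 := congrArg QuaternionAlgebra.imJ h
  have h3 := congrArg QuaternionAlgebra.imK h
  simp at h0 h1 h2 h3
  by_contra hne
  have e1 : J.imI = 0 := by
    have : J.re * J.imI = 0 := by linarith
    exact (mul_eq_zero.1 this).resolve_left hne
  have e2 : J.imJ = 0 := by
    have : J.re * J.imJ = 0 := by linarith
    exact (mul_eq_zero.1 this).resolve_left hne
  have e3 : J.imK = 0 := by
    have : J.re * J.imK = 0 := by linarith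
    exact (mul_eq_zero.1 this).resolve_left hne
  rw [e1, e2, e3] at h0
  nlinarith [mul_self_nonneg J.re]

theorem norm_unit {J : ℍ[ℝ]} (hJ : J ∈ unitSphere) : ‖J‖ = 1 := by
  have h : ‖J * J‖ = 1 := by rw [sq_unit hJ]; simp
  rw [norm_mul] at h
  nlinarith [norm_nonneg J]

/-- At a nonreal point `α + I β` the unit chosen in the operators is `± I`. -/
theorem unitOf_eq {I : ℍ[ℝ]} (hI : I ∈ unitSphere) (a b : ℝ) (hb : b ≠ 0) :
    unitOf ((a : ℍ[ℝ]) + I * (b : ℍ[ℝ])) = I ∨ unitOf ((a : ℍ[ℝ]) + I * (b : ℍ[ℝ])) = -I := by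
  have him : ((a : ℍ[ℝ]) + I * (b : ℍ[ℝ])).im = b • I := by
    have := re_unit hI
    ext <;> simp [this, mul_comm]
  have hI0 : I ≠ 0 := by
    intro h0
    have := norm_unit hI
    simp [h0] at this
  have hne : ¬ (b • I = 0) := by simp [hb, hI0]
  unfold unitOf
  rw [him, if_neg hne, norm_smul, norm_unit hI, mul_one, smul_smul, Real.norm_eq_abs]
  rcases lt_or_gt_of_ne hb with h | h
  · right
    rw [abs_of_neg h, inv_neg, neg_mul, inv_mul_cancel₀ hb, neg_smul, one_smul]
  · left
    rw [abs_of_pos h, inv_mul_cancel₀ hb, one_smul]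

theorem unitOf_mem (q : ℍ[ℝ]) : unitOf q ∈ unitSphere := by
  unfold unitOf
  split_ifs with h
  · show _ ^ 2 = _
    rw [sq]
    have h0 : unitI.re = 0 := rfl
    have h1 : unitI.imI = 1 := rfl
    have h2 : unitI.imJ = 0 := rfl
    have h3 : unitI.imK = 0 := rfl
    ext <;> simp [h0, h1, h2, h3]
  · show _ ^ 2 = _
    have hn : ‖q.im‖ ≠ 0 := by simpa using h
    rw [smul_pow, Quaternion.sq_eq_neg_normSq.2 (by simp), Quaternion.normSq_eq_norm_mul_self]
    rw [smul_neg, ← Quaternion.coe_smul]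
    have : ‖q.im‖⁻¹ ^ 2 • (‖q.im‖ * ‖q.im‖) = (1 : ℝ) := by
      rw [smul_eq_mul]
      field_simp
    rw [this]
    simp

theorem hasDerivAt_fst {g : ℝ → HC} {g' : HC} {t : ℝ} (h : HasDerivAt g g' t) :
    HasDerivAt (fun s => (g s).1) g'.1 t :=
  (ContinuousLinearMap.fst ℝ ℍ[ℝ] ℍ[ℝ]).hasFDerivAt.comp_hasDerivAt t h

theorem hasDerivAt_snd {g : ℝ → HC} {g' : HC} {t : ℝ} (h : HasDerivAt g g' t) :
    HasDerivAt (fun s => (g s).2) g'.2 t :=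
  (ContinuousLinearMap.snd ℝ ℍ[ℝ] ℍ[ℝ]).hasFDerivAt.comp_hasDerivAt t h

/-- The directional derivative along `ℂ_J` of a slice function. -/
theorem lineDeriv_induced {F : ℂ → HC} {f : ℍ[ℝ] → ℍ[ℝ]} {D : Set ℂ} (hD : IsOpen D)
    (hF : Induces F f D) {z : ℂ} (hz : z ∈ D) (hd : DifferentiableAt ℝ F z)
    {J : ℍ[ℝ]} (hJ : J ∈ unitSphere) (v : ℂ) :
    lineDeriv ℝ f ((z.re : ℍ[ℝ]) + J * (z.im : ℍ[ℝ])) ((v.re : ℍ[ℝ]) + J * (v.im : ℍ[ℝ])) =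
      (fderiv ℝ F z v).1 + J * (fderiv ℝ F z v).2 := by
  have hline : HasDerivAt (fun t : ℝ => F (z + t • v)) (fderiv ℝ F z v) 0 :=
    hd.hasFDerivAt.hasLineDerivAt v
  have h1 : HasDerivAt (fun t : ℝ => (F (z + t • v)).1 + J * (F (z + t • v)).2)
      ((fderiv ℝ F z v).1 + J * (fderiv ℝ F z v).2) 0 :=
    (hasDerivAt_fst hline).add ((hasDerivAt_snd hline).const_mul J)
  refine HasDerivAt.deriv (h1.congr_of_eventuallyEq ?_)
  have hc : Continuous (fun t : ℝ => z + t • v) := by fun_prop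
  have : ∀ᶠ t : ℝ in nhds 0, z + t • v ∈ D :=
    hc.continuousAt.eventually_mem (hD.mem_nhds (by simpa using hz))
  filter_upwards [this] with t ht
  rw [← hF _ ht J hJ]
  congr 1
  ext <;> simp <;> ring

theorem dI_induced {F : ℂ → HC} {f : ℍ[ℝ] → ℍ[ℝ]} {D : Set ℂ} (hD : IsOpen D)
    (hF : Induces F f D) {z : ℂ} (hz : z ∈ D) (hd : DifferentiableAt ℝ F z)
    {J : ℍ[ℝ]} (hJ : J ∈ unitSphere) :
    dI J f ((z.re : ℍ[ℝ]) + J * (z.im : ℍ[ℝ])) = (dz F z).1 + J * (dz F z).2 ∧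
    dbarI J f ((z.re : ℍ[ℝ]) + J * (z.im : ℍ[ℝ])) = (dzbar F z).1 + J * (dzbar F z).2 := by
  have h1 := lineDeriv_induced hD hF hz hd hJ 1
  have h2 := lineDeriv_induced hD hF hz hd hJ Complex.I
  simp only [Complex.one_re, Complex.one_im, Complex.I_re, Complex.I_im, Quaternion.coe_one,
    Quaternion.coe_zero, mul_zero, add_zero, mul_one, zero_add] at h1 h2
  have hJJ := sq_unit hJ
  have key : ∀ a b : ℍ[ℝ], J * (a + J * b) = J * a - b := by
    intro a b
    rw [mul_add, ← mul_assoc, hJJ, neg_one_mul, sub_eq_add_neg]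
  constructor
  · rw [dI, h1, h2, key, dz]
    simp only [iotaMul, Prod.smul_fst, Prod.smul_snd, Prod.fst_sub, Prod.snd_sub,
      mul_smul_comm, ← smul_add, mul_sub]
    congr 1
    abel
  · rw [dbarI, h1, h2, key, dzbar]
    simp only [iotaMul, Prod.smul_fst, Prod.smul_snd, Prod.fst_add, Prod.snd_add,
      mul_smul_comm, ← smul_add, mul_add]
    congr 1
    abel

/-- `∂F/∂z` and `∂F/∂z̄` are again stem functions. -/
theorem dz_stem {F : ℂ → HC} {D : Set ℂ} (hD : IsOpen D) (hs : IsSymmetric D)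
    (hF : IsStemOn F D) (hd : ∀ z ∈ D, DifferentiableAt ℝ F z) :
    IsStemOn (dz F) D ∧ IsStemOn (dzbar F) D := by
  have key : ∀ z ∈ D, ∀ v : ℂ,
      fderiv ℝ F ((starRingEnd ℂ) z) ((starRingEnd ℂ) v) = conjHC (fderiv ℝ F z v) := by
    intro z hz v
    have h1 : HasDerivAt (fun t : ℝ => F ((starRingEnd ℂ) z + t • (starRingEnd ℂ) v))
        (fderiv ℝ F ((starRingEnd ℂ) z) ((starRingEnd ℂ) v)) 0 :=
      (hd _ (hs z hz)).hasFDerivAt.hasLineDerivAt _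
    have h2 : HasDerivAt (fun t : ℝ => F (z + t • v)) (fderiv ℝ F z v) 0 :=
      (hd z hz).hasFDerivAt.hasLineDerivAt v
    have h3 : HasDerivAt (fun t : ℝ => conjHC (F (z + t • v))) (conjHC (fderiv ℝ F z v)) 0 :=
      (hasDerivAt_fst h2).prodMk (hasDerivAt_snd h2).neg
    refine h1.unique (h3.congr_of_eventuallyEq ?_)
    have hc : Continuous (fun t : ℝ => z + t • v) := by fun_prop
    have : ∀ᶠ t : ℝ in nhds 0, z + t • v ∈ D :=
      hc.continuousAt.eventually_mem (hD.mem_nhds (by simpa using hz))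
    filter_upwards [this] with t ht
    rw [← hF _ ht]
    simp
  constructor <;> intro z hz
  all_goals
    have h1 := key z hz 1
    have h2 := key z hz Complex.I
    simp only [map_one, Complex.conj_I, map_neg] at h1 h2
    rw [neg_eq_iff_eq_neg] at h2
    simp only [dz, dzbar, h1, h2, conjHC, iotaMul]
    ext1 <;> simp [smul_add, smul_sub] <;> abel

theorem stem_snd_real {F : ℂ → HC} {D : Set ℂ} (hF : IsStemOn F D) {z : ℂ} (hz : z ∈ D)
    (h0 : z.im = 0) : (F z).2 = 0 := by
  have h := hF z hz
  rw [Complex.conj_eq_iff_im.2 h0] at h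
  have h2 : (F z).2 = -(F z).2 := congrArg Prod.snd h
  ext
  · have := congrArg QuaternionAlgebra.re h2
    simp at this ⊢
    linarith
  · have := congrArg QuaternionAlgebra.imI h2
    simp at this ⊢
    linarith
  · have := congrArg QuaternionAlgebra.imJ h2
    simp at this ⊢
    linarith
  · have := congrArg QuaternionAlgebra.imK h2
    simp at this ⊢
    linarith

theorem star_eq_aux {G : ℂ → HC} {D : Set ℂ} (hs : IsSymmetric D) (hG : IsStemOn G D)
    {P : ℍ[ℝ] → ℍ[ℝ] → ℍ[ℝ]}
    (h : ∀ z ∈ D, ∀ J ∈ unitSphere,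
      P J ((z.re : ℍ[ℝ]) + J * (z.im : ℍ[ℝ])) = (G z).1 + J * (G z).2) :
    Induces G (fun q => P (unitOf q) q) D := by
  intro z hz I hI
  show P (unitOf ((z.re : ℍ[ℝ]) + I * (z.im : ℍ[ℝ]))) _ = _
  by_cases h0 : z.im = 0
  · have := h z hz _ (unitOf_mem ((z.re : ℍ[ℝ]) + I * (z.im : ℍ[ℝ])))
    rw [stem_snd_real hG hz h0] at this ⊢
    simpa [h0] using this
  · rcases unitOf_eq hI z.re z.im h0 with e | e
    · rw [e]
      exact h z hz I hI
    · rw [e]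
      have := h _ (hs z hz) _ (neg_unit hI)
      rw [hG z hz] at this
      simpa [conjHC] using this

/-- For a slice function `f = 𝓘(F)`, the operator gives `∂_* f = 𝓘(∂F/∂z)`, also at real points. -/
theorem dStar_eq {F : ℂ → HC} {f : ℍ[ℝ] → ℍ[ℝ]} {D : Set ℂ} (hD : IsOpen D)
    (hs : IsSymmetric D) (hF : IsStemOn F D) (hi : Induces F f D)
    (hd : ∀ z ∈ D, DifferentiableAt ℝ F z) : Induces (dz F) (dStar f) D :=
  star_eq_aux (P := fun J => dI J f) hs (dz_stem hD hs hF hd).1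
    fun z hz _ hJ => (dI_induced hD hi hz (hd z hz) hJ).1

/-- For a slice function `f = 𝓘(F)`, the operator gives `∂̄_* f = 𝓘(∂F/∂z̄)`, also at real points. -/
theorem dbarStar_eq {F : ℂ → HC} {f : ℍ[ℝ] → ℍ[ℝ]} {D : Set ℂ} (hD : IsOpen D)
    (hs : IsSymmetric D) (hF : IsStemOn F D) (hi : Induces F f D)
    (hd : ∀ z ∈ D, DifferentiableAt ℝ F z) : Induces (dzbar F) (dbarStar f) D :=
  star_eq_aux (P := fun J => dbarI J f) hs (dz_stem hD hs hF hd).2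
    fun z hz _ hJ => (dI_induced hD hi hz (hd z hz) hJ).2

end SliceFun

end

open SliceFun

/-! Everything is transferred to the stem function `F`. It is unique (`Induces.eqOn`), it is C² when
`f` is (`Induces.contDiffAt`), and `Δ_* f = 0` says `∂(∂̄F) = 0`, that is, `∂̄F` is
anti-holomorphic. On a simply connected `D` such a function is `∂̄K` for an anti-holomorphic stem
function `K` (`AntiHolomorphicOn.exists_stem_primitive`), and then `F - K` is holomorphic; this is
(1). Conversely, `∂̄` kills a holomorphic summand and commutes with `∂` on an anti-holomorphic one.

For (2), slice-preserving means that the stem function has values in `ℝ ⊗ ℂ`, i.e. `imL` kills it.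
Since `imL` commutes with `ι`, it commutes with `∂` and `∂̄`, so a real `F` has real derivatives and
its summands can be chosen real. Under (d), `∂F` and the conjugate of `∂̄F` are holomorphic and real
on `D ∩ ℝ`, hence real on `D` by the identity theorem; so `imL F` has zero derivative and vanishes
at `p`. Finally `∂ + ∂̄` is the derivative along the real axis: if `f` is real there, then either of
`∂_* f`, `∂̄_* f` is real there as soon as the other is, which links (b), (c) and (d). -/

open scoped Quaternion
open SliceFun
open Filter Topology

/-! ### Primitives on simply connected plane domains, by gluing local ones. -/

section Primitive

/-- On a simply connected space, local functions that differ by locally constant functions can be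
corrected by locally constant functions so as to agree globally. -/
theorem exists_glue_of_locally_const {X A : Type*} [TopologicalSpace X] [SimplyConnectedSpace X]
    [LocallyPathConnectedSpace X] [AddCommGroup A] (U : X → Set X) (hU : ∀ i, IsOpen (U i))
    (hmem : ∀ x, x ∈ U x) (g : X → X → A)
    (hg : ∀ i j, ∀ x ∈ U i ∩ U j, ∀ᶠ y in 𝓝 x, g i y - g j y = g i x - g j x) :
    ∃ G : X → A, ∀ x, ∀ᶠ y in 𝓝 x, G y - g x y = G x - g x x := by
  -- With `A` discrete, the locally constant differences `g i - g j` are continuous transition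
  -- functions of a bundle with discrete fibre, hence of a covering of `X`.
  let _ : TopologicalSpace A := ⊥
  have : DiscreteTopology A := ⟨rfl⟩
  let Z : FiberBundleCore X X A :=
    { baseSet := U
      isOpen_baseSet := hU
      indexAt := id
      mem_baseSet_at := hmem
      coordChange := fun i j x v => v + (g i x - g j x)
      coordChange_self := by intros; simp
      continuousOn_coordChange := by
        rintro i j ⟨x, v⟩ ⟨hx, -⟩
        refine ContinuousAt.continuousWithinAt ?_
        have h1 : ContinuousAt (fun p : X × A => g i p.1 - g j p.1) (x, v) := by
          have : ContinuousAt (fun y : X => g i y - g j y) x :=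
            (continuousAt_const (y := g i x - g j x)).congr (by
              filter_upwards [hg i j x hx] with y hy using hy.symm)
          exact ContinuousAt.comp (f := Prod.fst) (x := (x, v)) this continuousAt_fst
        have h2 : Continuous (fun p : A × A => p.1 + p.2) := continuous_of_discreteTopology
        exact h2.continuousAt.comp (continuousAt_snd.prodMk h1)
      coordChange_comp := by intros; abel }
  have hcov : IsCoveringMap (Bundle.TotalSpace.proj : Z.TotalSpace → X) :=
    FiberBundle.isCoveringMap
  obtain ⟨x₀⟩ : Nonempty X := inferInstance
  -- Lifting the identity of the simply connected `X` yields a global section of the covering.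
  obtain ⟨s, ⟨-, hs⟩, -⟩ := hcov.existsUnique_continuousMap_lifts (ContinuousMap.id X) x₀
    (⟨x₀, (0 : A)⟩ : Z.TotalSpace) rfl
  have hs' : ∀ x, (s x).1 = x := fun x => congrFun hs x
  let v : X → A := fun x => (s x).2
  -- As `indexAt = id`, `v x` is the coordinate in the chart with index `x` itself. In a fixed chart
  -- `x` the section reads `v y + g y y - g x y = G y - g x y`, which is locally constant because
  -- the fibre is discrete.
  refine ⟨fun x => v x + g x x, fun x => ?_⟩
  have hx : (Z.localTriv x).source ∈ 𝓝 (s x) :=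
    (Z.localTriv x).open_source.mem_nhds (by
      rw [Z.mem_localTriv_source, hs']; exact hmem x)
  have hc : ContinuousAt (fun y => (Z.localTriv x (s y)).2) x :=
    continuousAt_snd.comp (((Z.localTriv x).continuousOn_toFun.continuousAt hx).comp
      s.continuous.continuousAt)
  have hval : ∀ y, (Z.localTriv x (s y)).2 = v y + (g y y - g x y) := by
    intro y
    change v y + (g (s y).1 (s y).1 - g x (s y).1) = _
    rw [hs']
  have hev : ∀ᶠ y in 𝓝 x, (Z.localTriv x (s y)).2 = (Z.localTriv x (s x)).2 :=
    hc.eventually_mem ((isOpen_discrete {(Z.localTriv x (s x)).2}).mem_nhds rfl)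
  filter_upwards [hev] with y hy
  rw [hval, hval] at hy
  simpa [add_sub_assoc] using hy

/-- A holomorphic function on a simply connected open subset of the plane has a primitive. -/
theorem DifferentiableOn.isExactOn_of_isSimplyConnected {V : Type*} [NormedAddCommGroup V]
    [NormedSpace ℂ V] [CompleteSpace V] {D : Set ℂ} (hD : IsOpen D) (hDsc : IsSimplyConnected D)
    {h : ℂ → V} (hh : DifferentiableOn ℂ h D) : Complex.IsExactOn h D := by
  classical
  have := hDsc.simplyConnectedSpace
  have := hD.locallyPathConnectedSpace
  have hball : ∀ x : D, ∃ r > 0, Metric.ball (x : ℂ) r ⊆ D :=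
    fun x => Metric.isOpen_iff.1 hD x x.2
  choose r hr hrD using hball
  have hprim : ∀ x : D, Complex.IsExactOn h (Metric.ball (x : ℂ) (r x)) :=
    fun x => (hh.mono (hrD x)).isExactOn_ball
  choose g hg using hprim
  obtain ⟨G, hG⟩ := exists_glue_of_locally_const
    (fun x : D => ((↑) : D → ℂ) ⁻¹' Metric.ball (x : ℂ) (r x))
    (fun x => Metric.isOpen_ball.preimage continuous_subtype_val)
    (fun x => Metric.mem_ball_self (hr x)) (fun x y => g x y) (by
      rintro i j x ⟨hi, hj⟩
      obtain ⟨ε, hε, hsub⟩ := Metric.isOpen_iff.1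
        (Metric.isOpen_ball.inter Metric.isOpen_ball) (x : ℂ) ⟨hi, hj⟩
      have hmem : ∀ᶠ y : D in 𝓝 x, (y : ℂ) ∈ Metric.ball (x : ℂ) ε :=
        continuous_subtype_val.continuousAt.eventually_mem (Metric.ball_mem_nhds _ hε)
      filter_upwards [hmem] with y hy
      have hder : ∀ z ∈ Metric.ball (x : ℂ) ε, HasDerivAt (fun z => g i z - g j z) 0 z :=
        fun z hz => by
          simpa using (hg i z (hsub hz).1).fun_sub (hg j z (hsub hz).2)
      -- Two primitives of `h` differ by a constant on a ball inside the overlap.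
      exact (convex_ball _ _).is_const_of_fderivWithin_eq_zero (𝕜 := ℂ)
        (fun z hz => (hder z hz).differentiableAt.differentiableWithinAt)
        (fun z hz => by
          rw [fderivWithin_of_isOpen Metric.isOpen_ball hz]
          simpa using (hder z hz).hasFDerivAt.fderiv) hy (Metric.mem_ball_self hε))
  refine ⟨fun z => if hz : z ∈ D then G ⟨z, hz⟩ else 0, fun z hz => ?_⟩
  have h1 := hG ⟨z, hz⟩
  have h2 : ∀ᶠ w in 𝓝 z, ∀ hw : w ∈ D,
      G ⟨w, hw⟩ - g ⟨z, hz⟩ w = G ⟨z, hz⟩ - g ⟨z, hz⟩ z := by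
    rw [nhds_subtype_eq_comap, eventually_comap] at h1
    filter_upwards [h1] with w hw hwD using hw ⟨w, hwD⟩ rfl
  have h3 := (hg ⟨z, hz⟩ z (Metric.mem_ball_self (hr _))).add_const
    (G ⟨z, hz⟩ - g ⟨z, hz⟩ z)
  refine h3.congr_of_eventuallyEq ?_
  filter_upwards [h2, hD.mem_nhds hz] with w hw hwD
  rw [dif_pos hwD, ← hw hwD]
  abel

end Primitive

/-! ### Complex coordinates on `ℍ ⊗ ℂ`. -/

noncomputable section

namespace SliceFun

/-- The identification `ℍ ⊗ ℂ ≃ ℂ⁴`, under which `ι` acts as multiplication by `i`. -/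
def complexCoords : HC ≃L[ℝ] (Fin 4 → ℂ) :=
  LinearEquiv.toContinuousLinearEquiv
    { toFun := fun w => ![⟨w.1.re, w.2.re⟩, ⟨w.1.imI, w.2.imI⟩, ⟨w.1.imJ, w.2.imJ⟩,
        ⟨w.1.imK, w.2.imK⟩]
      invFun := fun c => (⟨(c 0).re, (c 1).re, (c 2).re, (c 3).re⟩,
        ⟨(c 0).im, (c 1).im, (c 2).im, (c 3).im⟩)
      map_add' := fun v w => by
        funext i; fin_cases i <;> apply Complex.ext <;> simp
      map_smul' := fun r w => by
        funext i; fin_cases i <;> apply Complex.ext <;> simp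
      left_inv := fun w => rfl
      right_inv := fun c => by
        funext i; fin_cases i <;> rfl }

theorem complexCoords_apply (w : HC) : complexCoords w =
    ![⟨w.1.re, w.2.re⟩, ⟨w.1.imI, w.2.imI⟩, ⟨w.1.imJ, w.2.imJ⟩, ⟨w.1.imK, w.2.imK⟩] := rfl

/-- Multiplication by `ι` as a continuous linear map. -/
def iotaL : HC →L[ℝ] HC :=
  (-ContinuousLinearMap.snd ℝ ℍ[ℝ] ℍ[ℝ]).prod (ContinuousLinearMap.fst ℝ ℍ[ℝ] ℍ[ℝ])

/-- Complex conjugation on `ℍ ⊗ ℂ` as a continuous linear map. -/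
def conjL : HC →L[ℝ] HC :=
  (ContinuousLinearMap.fst ℝ ℍ[ℝ] ℍ[ℝ]).prod (-ContinuousLinearMap.snd ℝ ℍ[ℝ] ℍ[ℝ])

/-- The projection of `ℍ ⊗ ℂ` onto its purely imaginary quaternionic part. -/
def imL : HC →L[ℝ] HC :=
  LinearMap.toContinuousLinearMap
    { toFun := fun w => (w.1.im, w.2.im)
      map_add' := fun v w => by simp
      map_smul' := fun r w => by simp }

theorem iotaL_apply (w : HC) : iotaL w = iotaMul w := rfl

theorem conjL_apply (w : HC) : conjL w = conjHC w := rfl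

theorem imL_apply (w : HC) : imL w = (w.1.im, w.2.im) := rfl

theorem iotaMul_iotaMul (w : HC) : iotaMul (iotaMul w) = -w := rfl

theorem conjHC_conjHC (w : HC) : conjHC (conjHC w) = w := by
  simp [conjHC]

theorem conjHC_zero : conjHC 0 = 0 := by
  simp [conjHC]

theorem conjHC_iotaMul (w : HC) : conjHC (iotaMul w) = -iotaMul (conjHC w) := by
  simp [conjHC, iotaMul]

theorem imL_iotaMul (w : HC) : imL (iotaMul w) = iotaMul (imL w) := by
  simp [imL_apply, iotaMul]

theorem imL_conjHC (w : HC) : imL (conjHC w) = conjHC (imL w) := by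
  simp [imL_apply, conjHC]

theorem imL_imL (w : HC) : imL (imL w) = imL w := by
  simp [imL_apply]

/-- This complex linearity turns `HolomorphicOn` into complex differentiability of four scalar
functions. -/
theorem complexCoords_iotaMul (w : HC) :
    complexCoords (iotaMul w) = Complex.I • complexCoords w := by
  funext i
  fin_cases i <;> apply Complex.ext <;> simp [complexCoords_apply, iotaMul]

theorem complexCoords_conjHC (w : HC) (i : Fin 4) :
    complexCoords (conjHC w) i = (starRingEnd ℂ) (complexCoords w i) := by
  fin_cases i <;> apply Complex.ext <;> simp [complexCoords_apply, conjHC]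

/-- Coordinate `0` carries the real quaternionic part; the other three belong to `i`, `j`, `k`. -/
theorem imL_eq_zero_iff (w : HC) : imL w = 0 ↔ ∀ i : Fin 3, complexCoords w i.succ = 0 := by
  simp [Fin.forall_fin_succ, complexCoords_apply, imL_apply, Prod.ext_iff, Quaternion.ext_iff,
    Complex.ext_iff]
  tauto

/-! ### Wirtinger derivatives -/

theorem dz_conjHC {F : ℂ → HC} {z : ℂ} (h : DifferentiableAt ℝ F z) :
    dz (fun w => conjHC (F w)) z = conjHC (dzbar F z) ∧
      dzbar (fun w => conjHC (F w)) z = conjHC (dz F z) := by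
  have e : fderiv ℝ (fun w => conjL (F w)) z = conjL.comp (fderiv ℝ F z) :=
    (conjL.hasFDerivAt.comp z h.hasFDerivAt).fderiv
  simp only [← conjL_apply]
  simp only [dz, dzbar, e, ContinuousLinearMap.comp_apply, ← iotaL_apply,
    map_smul, map_add, map_sub]
  have key : ∀ w, conjL (iotaL w) = -iotaL (conjL w) := conjHC_iotaMul
  simp [key, sub_eq_add_neg]

theorem differentiableAt_conjHC {F : ℂ → HC} {z : ℂ} (h : DifferentiableAt ℝ F z) :
    DifferentiableAt ℝ (fun w => conjHC (F w)) z :=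
  conjL.differentiableAt.comp z h

theorem dz_imL {F : ℂ → HC} {z : ℂ} (h : DifferentiableAt ℝ F z) :
    dz (fun w => imL (F w)) z = imL (dz F z) ∧
      dzbar (fun w => imL (F w)) z = imL (dzbar F z) := by
  have e : fderiv ℝ (fun w => imL (F w)) z = imL.comp (fderiv ℝ F z) :=
    (imL.hasFDerivAt.comp z h.hasFDerivAt).fderiv
  have key : ∀ w, imL (iotaL w) = iotaL (imL w) := imL_iotaMul
  simp [dz, dzbar, e, ContinuousLinearMap.comp_apply, ← iotaL_apply, key]

theorem differentiableAt_imL {F : ℂ → HC} {z : ℂ} (h : DifferentiableAt ℝ F z) :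
    DifferentiableAt ℝ (fun w => imL (F w)) z :=
  imL.differentiableAt.comp z h

theorem dz_add {F G : ℂ → HC} {z : ℂ} (hF : DifferentiableAt ℝ F z)
    (hG : DifferentiableAt ℝ G z) :
    dz (fun w => F w + G w) z = dz F z + dz G z ∧
      dzbar (fun w => F w + G w) z = dzbar F z + dzbar G z := by
  simp only [dz, dzbar, fderiv_fun_add hF hG, add_apply, ← iotaL_apply, map_add,
    ← smul_add]
  constructor <;> congr 1 <;> abel

theorem dz_sub {F G : ℂ → HC} {z : ℂ} (hF : DifferentiableAt ℝ F z)
    (hG : DifferentiableAt ℝ G z) :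
    dz (fun w => F w - G w) z = dz F z - dz G z ∧
      dzbar (fun w => F w - G w) z = dzbar F z - dzbar G z := by
  simp only [dz, dzbar, fderiv_fun_sub hF hG, sub_apply, ← iotaL_apply, map_sub,
    ← smul_sub]
  constructor <;> congr 1 <;> abel

theorem dz_congr {F G : ℂ → HC} {z : ℂ} (h : F =ᶠ[𝓝 z] G) :
    dz F z = dz G z ∧ dzbar F z = dzbar G z := by
  simp only [dz, dzbar, h.fderiv_eq, and_self]

theorem dz_zero (z : ℂ) : dz (fun _ => 0) z = 0 ∧ dzbar (fun _ => 0) z = 0 := by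
  simp [dz, dzbar, iotaMul]

theorem fderiv_one_eq (F : ℂ → HC) (z : ℂ) : fderiv ℝ F z 1 = dz F z + dzbar F z := by
  simp only [dz, dzbar, ← smul_add]
  rw [sub_add_add_cancel, ← two_smul ℝ, smul_smul]
  norm_num

theorem fderiv_I_eq (F : ℂ → HC) (z : ℂ) :
    fderiv ℝ F z Complex.I = iotaMul (dz F z - dzbar F z) := by
  simp only [dz, dzbar, ← smul_sub, ← iotaL_apply, map_smul, map_sub, map_add]
  simp only [iotaL_apply, iotaMul_iotaMul]
  module

/-- By the Cauchy–Riemann equation `dzbar F z = 0`, the real derivative sends `1` to `dz F z` and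
`i` to `ι` times it, so it is complex linear. -/
theorem HolomorphicOn.hasDerivAt {F : ℂ → HC} {D : Set ℂ} (h : HolomorphicOn F D) {z : ℂ}
    (hz : z ∈ D) : HasDerivAt (fun w => complexCoords (F w)) (complexCoords (dz F z)) z := by
  have h1 : HasFDerivAt (fun w => complexCoords (F w))
      ((complexCoords : HC →L[ℝ] (Fin 4 → ℂ)).comp (fderiv ℝ F z)) z :=
    complexCoords.hasFDerivAt.comp z (h.1 z hz).hasFDerivAt
  refine hasDerivAt_iff_hasFDerivAt.2 (hasFDerivAt_of_restrictScalars ℝ h1 ?_)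
  have e1 := fderiv_one_eq F z
  have e2 := fderiv_I_eq F z
  rw [h.2 z hz, add_zero] at e1
  rw [h.2 z hz, sub_zero] at e2
  ext v : 1
  have hv : v = v.re • (1 : ℂ) + v.im • Complex.I := by simp
  rw [ContinuousLinearMap.comp_apply]
  conv_rhs => rw [hv]
  rw [map_add, map_smul, map_smul, e1, e2, ContinuousLinearEquiv.coe_coe, map_add, map_smul,
    map_smul, complexCoords_iotaMul]
  change v • complexCoords (dz F z) = _
  conv_lhs => rw [hv, add_smul, smul_assoc, smul_assoc, one_smul]

theorem of_hasDerivAt_complexCoords {F : ℂ → HC} {w : HC} {z : ℂ}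
    (h : HasDerivAt (fun u => complexCoords (F u)) (complexCoords w) z) :
    DifferentiableAt ℝ F z ∧ dz F z = w ∧ dzbar F z = 0 := by
  have h1 := h.hasFDerivAt.restrictScalars ℝ
  have h2 := complexCoords.symm.hasFDerivAt.comp z h1
  have h3 : complexCoords.symm ∘ (fun u => complexCoords (F u)) = F := by
    funext u; simp
  rw [h3] at h2
  have e1 : fderiv ℝ F z 1 = w := by rw [h2.fderiv]; simp
  have e2 : fderiv ℝ F z Complex.I = iotaMul w := by
    rw [h2.fderiv, ContinuousLinearMap.comp_apply]
    apply complexCoords.injective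
    simp [complexCoords_iotaMul]
  refine ⟨h2.differentiableAt, ?_, ?_⟩
  · rw [dz, e1, e2, iotaMul_iotaMul, sub_neg_eq_add, ← two_smul ℝ, smul_smul]
    norm_num
  · rw [dzbar, e1, e2, iotaMul_iotaMul]
    simp

/-- Conjugation in the target exchanges `∂` and `∂̄`; through this, anti-holomorphic statements
reduce to holomorphic ones. -/
theorem antiHolomorphicOn_iff_conjHC {F : ℂ → HC} {D : Set ℂ} :
    AntiHolomorphicOn F D ↔ HolomorphicOn (fun z => conjHC (F z)) D := by
  constructor
  · rintro ⟨h1, h2⟩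
    exact ⟨fun z hz => differentiableAt_conjHC (h1 z hz), fun z hz => by
      rw [(dz_conjHC (h1 z hz)).2, h2 z hz, conjHC_zero]⟩
  · rintro ⟨h1, h2⟩
    have e : F = fun z => conjHC (conjHC (F z)) := by simp [conjHC_conjHC]
    have hd : ∀ z ∈ D, DifferentiableAt ℝ F z := fun z hz => by
      rw [e]; exact differentiableAt_conjHC (h1 z hz)
    refine ⟨hd, fun z hz => ?_⟩
    have := h2 z hz
    rw [(dz_conjHC (hd z hz)).2] at this
    rw [← conjHC_conjHC (dz F z), this, conjHC_zero]

/-- `HolomorphicOn` asks only for real differentiability; the second derivatives come from complex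
analyticity. -/
theorem HolomorphicOn.contDiffAt {F : ℂ → HC} {D : Set ℂ} (hD : IsOpen D)
    (h : HolomorphicOn F D) {z : ℂ} (hz : z ∈ D) : ContDiffAt ℝ 2 F z := by
  have h1 : DifferentiableOn ℂ (fun w => complexCoords (F w)) D :=
    fun w hw => (h.hasDerivAt hw).differentiableAt.differentiableWithinAt
  have h2 : ContDiffAt ℝ 2 (fun w => complexCoords (F w)) z :=
    ((h1.contDiffOn hD).contDiffAt (hD.mem_nhds hz)).restrict_scalars ℝ
  simpa [Function.comp_def] using complexCoords.symm.contDiff.contDiffAt.comp z h2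

theorem AntiHolomorphicOn.contDiffAt {F : ℂ → HC} {D : Set ℂ} (hD : IsOpen D)
    (h : AntiHolomorphicOn F D) {z : ℂ} (hz : z ∈ D) : ContDiffAt ℝ 2 F z := by
  have := conjL.contDiff.contDiffAt.comp z
    ((antiHolomorphicOn_iff_conjHC.1 h).contDiffAt hD hz)
  simpa [Function.comp_def, conjL_apply, conjHC_conjHC] using this

theorem hasFDerivAt_dz {F : ℂ → HC} {z : ℂ} (h : ContDiffAt ℝ 2 F z) :
    DifferentiableAt ℝ (dz F) z ∧ DifferentiableAt ℝ (dzbar F) z ∧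
    (∀ v, fderiv ℝ (dz F) z v = (1 / 2 : ℝ) •
      (fderiv ℝ (fderiv ℝ F) z v 1 - iotaMul (fderiv ℝ (fderiv ℝ F) z v Complex.I))) ∧
    ∀ v, fderiv ℝ (dzbar F) z v = (1 / 2 : ℝ) •
      (fderiv ℝ (fderiv ℝ F) z v 1 + iotaMul (fderiv ℝ (fderiv ℝ F) z v Complex.I)) := by
  have h1 : DifferentiableAt ℝ (fderiv ℝ F) z :=
    (h.fderiv_right (m := 1) (by norm_num)).differentiableAt (by norm_num)
  have hv : ∀ v : ℂ, HasFDerivAt (fun w => fderiv ℝ F w v)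
      ((ContinuousLinearMap.apply ℝ HC v).comp (fderiv ℝ (fderiv ℝ F) z)) z := fun v =>
    (ContinuousLinearMap.apply ℝ HC v).hasFDerivAt.comp z h1.hasFDerivAt
  have hI := iotaL.hasFDerivAt.comp z (hv Complex.I)
  have ha := ((hv 1).sub hI).const_smul (1 / 2 : ℝ)
  have hb := ((hv 1).add hI).const_smul (1 / 2 : ℝ)
  refine ⟨ha.differentiableAt, hb.differentiableAt, fun v => ?_, fun v => ?_⟩
  · exact congrArg (fun L : ℂ →L[ℝ] HC => L v) ha.fderiv
  · exact congrArg (fun L : ℂ →L[ℝ] HC => L v) hb.fderiv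

/-- Symmetry of the second derivative: both sides are a quarter of the Laplacian. -/
theorem dz_dzbar_comm {F : ℂ → HC} {z : ℂ} (h : ContDiffAt ℝ 2 F z) :
    dz (dzbar F) z = dzbar (dz F) z := by
  obtain ⟨-, -, ha, hb⟩ := hasFDerivAt_dz h
  have hs := h.isSymmSndFDerivAt (by simp) 1 Complex.I
  rw [dz, dzbar, ha, hb, ha, hb, hs]
  simp only [← iotaL_apply, map_smul, map_add, map_sub]
  simp only [iotaL_apply, iotaMul_iotaMul]
  module

theorem AntiHolomorphicOn.dz_dzbar_eq_zero {F : ℂ → HC} {D : Set ℂ} (hD : IsOpen D)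
    (h : AntiHolomorphicOn F D) {z : ℂ} (hz : z ∈ D) : dz (dzbar F) z = 0 := by
  rw [dz_dzbar_comm (h.contDiffAt hD hz)]
  have : dz F =ᶠ[𝓝 z] fun _ => 0 := by
    filter_upwards [hD.mem_nhds hz] with w hw using h.2 w hw
  rw [(dz_congr this).2, (dz_zero z).2]

end SliceFun

end

noncomputable section

namespace SliceFun

/-! ### Primitives of holomorphic stem functions -/

theorem HolomorphicOn.exists_primitive {H : ℂ → HC} {D : Set ℂ} (hD : IsOpen D)
    (hDsc : IsSimplyConnected D) (h : HolomorphicOn H D) :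
    ∃ K : ℂ → HC, ∀ z ∈ D,
      HasDerivAt (fun w => complexCoords (K w)) (complexCoords (H z)) z := by
  have h1 : DifferentiableOn ℂ (fun w => complexCoords (H w)) D :=
    fun w hw => (h.hasDerivAt hw).differentiableAt.differentiableWithinAt
  obtain ⟨k, hk⟩ := h1.isExactOn_of_isSimplyConnected hD hDsc
  exact ⟨fun z => complexCoords.symm (k z), fun z hz => by simpa using hk z hz⟩

/-- Schwarz reflection, applied in each coordinate. -/
theorem hasDerivAt_conjHC_conj {K : ℂ → HC} {w : HC} {z : ℂ}
    (h : HasDerivAt (fun u => complexCoords (K u)) (complexCoords w) ((starRingEnd ℂ) z)) :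
    HasDerivAt (fun u => complexCoords (conjHC (K ((starRingEnd ℂ) u))))
      (complexCoords (conjHC w)) z := by
  rw [hasDerivAt_pi] at h ⊢
  intro i
  have := (h i).conj_conj
  simpa [complexCoords_conjHC, Function.comp_def] using this

/-- A holomorphic stem function on a simply connected domain is the derivative of a holomorphic
stem function. -/
theorem HolomorphicOn.exists_stem_primitive {H : ℂ → HC} {D : Set ℂ} (hD : IsOpen D)
    (hDsc : IsSimplyConnected D) (hs : IsSymmetric D) (h : HolomorphicOn H D)
    (hstem : IsStemOn H D) :
    ∃ K : ℂ → HC, IsStemOn K D ∧ HolomorphicOn K D ∧ ∀ z ∈ D, SliceFun.dz K z = H z := by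
  obtain ⟨K, hK⟩ := h.exists_primitive hD hDsc
  -- Averaging `K` with its reflection makes it a stem function. The derivative is unchanged, since
  -- `H` is a stem function and so equals its own reflection.
  let K' : ℂ → HC := fun z => (1 / 2 : ℝ) • (K z + conjHC (K ((starRingEnd ℂ) z)))
  have hK' : ∀ z ∈ D, HasDerivAt (fun w => complexCoords (K' w)) (complexCoords (H z)) z := by
    intro z hz
    have h1 := hK z hz
    have h2 := hasDerivAt_conjHC_conj (hK _ (hs z hz))
    rw [hstem z hz, conjHC_conjHC] at h2
    have h3 := (h1.fun_add h2).fun_const_smul (1 / 2 : ℝ)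
    have e : complexCoords (H z) =
        (1 / 2 : ℝ) • (complexCoords (H z) + complexCoords (H z)) := by module
    rw [e]
    simpa only [K', map_smul, map_add] using h3
  refine ⟨K', fun z _ => ?_, ⟨fun z hz => (of_hasDerivAt_complexCoords (hK' z hz)).1,
    fun z hz => (of_hasDerivAt_complexCoords (hK' z hz)).2.2⟩,
    fun z hz => (of_hasDerivAt_complexCoords (hK' z hz)).2.1⟩
  simp only [K', Complex.conj_conj, ← conjL_apply, map_smul, map_add]
  simp only [conjL_apply, conjHC_conjHC]
  rw [add_comm]

theorem IsStemOn.conjHC {F : ℂ → HC} {D : Set ℂ} (h : IsStemOn F D) :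
    IsStemOn (fun z => SliceFun.conjHC (F z)) D := fun z hz => congrArg SliceFun.conjHC (h z hz)

/-- An anti-holomorphic stem function on a simply connected domain is the `∂/∂z̄`-derivative of an
anti-holomorphic stem function. -/
theorem AntiHolomorphicOn.exists_stem_primitive {H : ℂ → HC} {D : Set ℂ} (hD : IsOpen D)
    (hDsc : IsSimplyConnected D) (hs : IsSymmetric D) (h : AntiHolomorphicOn H D)
    (hstem : IsStemOn H D) :
    ∃ K : ℂ → HC, IsStemOn K D ∧ AntiHolomorphicOn K D ∧ ∀ z ∈ D, dzbar K z = H z := by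
  obtain ⟨K, hK, hKh, hKd⟩ :=
    (antiHolomorphicOn_iff_conjHC.1 h).exists_stem_primitive hD hDsc hs hstem.conjHC
  refine ⟨fun z => SliceFun.conjHC (K z), hK.conjHC, ?_, fun z hz => ?_⟩
  · rw [antiHolomorphicOn_iff_conjHC]
    simpa only [conjHC_conjHC] using hKh
  · rw [(dz_conjHC (hKh.1 z hz)).2, hKd z hz, conjHC_conjHC]

/-- Identity theorem for the three imaginary coordinates: they vanish at the real points of `D`,
which accumulate at `x₀`. -/
theorem HolomorphicOn.imL_eq_zero {A : ℂ → HC} {D : Set ℂ} (hD : IsOpen D)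
    (hconn : IsConnected D) (h : HolomorphicOn A D) {x₀ : ℝ} (hx₀ : (x₀ : ℂ) ∈ D)
    (hreal : ∀ x : ℝ, (x : ℂ) ∈ D → imL (A x) = 0) : ∀ z ∈ D, imL (A z) = 0 := by
  intro z hz
  rw [imL_eq_zero_iff]
  intro i
  have han : AnalyticOnNhd ℂ (fun w => complexCoords (A w) i.succ) D :=
    DifferentiableOn.analyticOnNhd
      (fun w hw =>
        (hasDerivAt_pi.1 (h.hasDerivAt hw) i.succ).differentiableAt.differentiableWithinAt) hD
  refine han.eqOn_zero_of_preconnected_of_frequently_eq_zero hconn.isPreconnected hx₀ ?_ hz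
  have hc : Tendsto (fun t : ℝ => (t : ℂ)) (𝓝[≠] x₀) (𝓝[≠] (x₀ : ℂ)) := by
    refine tendsto_nhdsWithin_iff.2 ⟨?_, ?_⟩
    · exact (Complex.continuous_ofReal.tendsto x₀).mono_left nhdsWithin_le_nhds
    · filter_upwards [self_mem_nhdsWithin] with t ht
      simpa using ht
  refine hc.frequently (Eventually.frequently ?_)
  have hev : ∀ᶠ t : ℝ in 𝓝[≠] x₀, (t : ℂ) ∈ D :=
    (Complex.continuous_ofReal.continuousAt.eventually_mem (hD.mem_nhds hx₀)).filter_mono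
      nhdsWithin_le_nhds
  filter_upwards [hev] with t ht
  exact (imL_eq_zero_iff _).1 (hreal t ht) i

/-! ### Slice functions and their stem functions -/

theorem unitI_coords : unitI.re = 0 ∧ unitI.imI = 1 ∧ unitI.imJ = 0 ∧ unitI.imK = 0 :=
  ⟨rfl, rfl, rfl, rfl⟩

theorem unitI_mem : unitI ∈ unitSphere := by
  change _ ^ 2 = _
  rw [sq]
  ext <;> simp [unitI_coords]

/-- The quaternion `j`. -/
def unitJ : ℍ[ℝ] := ⟨0, 0, 1, 0⟩

theorem unitJ_coords : unitJ.re = 0 ∧ unitJ.imI = 0 ∧ unitJ.imJ = 1 ∧ unitJ.imK = 0 :=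
  ⟨rfl, rfl, rfl, rfl⟩

theorem unitJ_mem : unitJ ∈ unitSphere := by
  change _ ^ 2 = _
  rw [sq]
  ext <;> simp [unitJ_coords]

theorem mem_circ {D : Set ℂ} {z : ℂ} (hz : z ∈ D) {I : ℍ[ℝ]} (hI : I ∈ unitSphere) :
    (z.re : ℍ[ℝ]) + I * (z.im : ℍ[ℝ]) ∈ circ D := ⟨z, hz, I, hI, rfl⟩

/-- The sum of the two equations isolates the first component; then `I` is cancelled by `I * I =
-1`. -/
theorem eq_of_add_mul_unit {I : ℍ[ℝ]} (hI : I ∈ unitSphere) {v w : HC}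
    (h1 : v.1 + I * v.2 = w.1 + I * w.2) (h2 : v.1 + -I * v.2 = w.1 + -I * w.2) : v = w := by
  have e1 : v.1 = w.1 := by
    have : (2 : ℝ) • v.1 = (2 : ℝ) • w.1 := by
      calc (2 : ℝ) • v.1 = (v.1 + I * v.2) + (v.1 + -I * v.2) := by
            rw [two_smul, neg_mul]; abel
        _ = (2 : ℝ) • w.1 := by rw [h1, h2, two_smul, neg_mul]; abel
    exact smul_right_injective _ two_ne_zero this
  rw [e1, add_right_inj] at h1
  have e2 : v.2 = w.2 := by
    have := congrArg (fun q => -(I * q)) h1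
    simpa [← mul_assoc, sq_unit hI] using this
  exact Prod.ext e1 e2

/-- The stem function of a slice function is unique. -/
theorem Induces.eqOn {F G : ℂ → HC} {f g : ℍ[ℝ] → ℍ[ℝ]} {D : Set ℂ} (hF : Induces F f D)
    (hG : Induces G g D) (h : ∀ q ∈ circ D, f q = g q) {z : ℂ} (hz : z ∈ D) : F z = G z := by
  refine eq_of_add_mul_unit unitI_mem ?_ ?_
  · rw [← hF z hz _ unitI_mem, ← hG z hz _ unitI_mem]
    exact h _ (mem_circ hz unitI_mem)
  · rw [← hF z hz _ (neg_unit unitI_mem), ← hG z hz _ (neg_unit unitI_mem)]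
    exact h _ (mem_circ hz (neg_unit unitI_mem))

theorem Induces.eq_of_eqOn {F G : ℂ → HC} {f g : ℍ[ℝ] → ℍ[ℝ]} {D : Set ℂ} (hF : Induces F f D)
    (hG : Induces G g D) (h : ∀ z ∈ D, F z = G z) : ∀ q ∈ circ D, f q = g q := by
  rintro q ⟨z, hz, I, hI, rfl⟩
  rw [hF z hz I hI, hG z hz I hI, h z hz]

theorem Induces.add {F G : ℂ → HC} {f g : ℍ[ℝ] → ℍ[ℝ]} {D : Set ℂ} (hF : Induces F f D)
    (hG : Induces G g D) : Induces (fun z => F z + G z) (fun q => f q + g q) D := by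
  intro z hz I hI
  simp only [hF z hz I hI, hG z hz I hI, Prod.fst_add, Prod.snd_add, mul_add]
  abel

theorem Induces.apply_real {F : ℂ → HC} {f : ℍ[ℝ] → ℍ[ℝ]} {D : Set ℂ} (hs : IsStemOn F D)
    (hF : Induces F f D) {x : ℝ} (hx : (x : ℂ) ∈ D) : f x = (F x).1 := by
  have := hF x hx _ unitI_mem
  rw [stem_snd_real hs hx (Complex.ofReal_im x)] at this
  simpa using this

theorem Induces.im_apply_real_eq_zero_iff {F : ℂ → HC} {f : ℍ[ℝ] → ℍ[ℝ]} {D : Set ℂ}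
    (hs : IsStemOn F D) (hF : Induces F f D) {x : ℝ} (hx : (x : ℂ) ∈ D) :
    (f x).im = 0 ↔ imL (F x) = 0 := by
  rw [hF.apply_real hs hx, imL_apply, stem_snd_real hs hx (Complex.ofReal_im x)]
  simp [Prod.ext_iff]

/-- Every stem function induces a slice function. -/
theorem IsStemOn.exists_induces {F : ℂ → HC} {D : Set ℂ} (hs : IsSymmetric D)
    (hF : IsStemOn F D) : ∃ f : ℍ[ℝ] → ℍ[ℝ], Induces F f D := by
  -- If `q = α + Jβ`, then `α = q.re` and `β = -(J q).re`; `star_eq_aux` takes care of the choice `J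
  -- = unitOf q`.
  refine ⟨_, star_eq_aux
    (P := fun J q => (F ⟨q.re, -(J * q).re⟩).1 + J * (F ⟨q.re, -(J * q).re⟩).2) hs hF ?_⟩
  intro z hz J hJ
  have h1 : ((z.re : ℍ[ℝ]) + J * (z.im : ℍ[ℝ])).re = z.re := by simp [re_unit hJ]
  have h2 : -(J * ((z.re : ℍ[ℝ]) + J * (z.im : ℍ[ℝ]))).re = z.im := by
    rw [mul_add, ← mul_assoc, sq_unit hJ]
    simp [re_unit hJ]
  simp only [h1, h2]

theorem isSlicePreservingOn_of_imL {F : ℂ → HC} {f : ℍ[ℝ] → ℍ[ℝ]} {D : Set ℂ}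
    (hs : IsStemOn F D) (hF : Induces F f D) (him : ∀ z ∈ D, imL (F z) = 0) :
    IsSlicePreservingOn f D := by
  rintro J hJ q ⟨⟨z, hz, I, hI, rfl⟩, a, b, hab⟩
  have h := him z hz
  rw [imL_apply, Prod.mk_eq_zero] at h
  have e1 : (F z).1 = ((F z).1.re : ℍ[ℝ]) := by
    conv_lhs => rw [← Quaternion.re_add_im (F z).1, h.1, add_zero]
  have e2 : (F z).2 = ((F z).2.re : ℍ[ℝ]) := by
    conv_lhs => rw [← Quaternion.re_add_im (F z).2, h.2, add_zero]
  rw [hF z hz I hI]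
  by_cases h0 : z.im = 0
  · rw [stem_snd_real hs hz h0, e1]
    exact ⟨(F z).1.re, 0, by simp⟩
  · have hre : z.re = a := by
      have := congrArg QuaternionAlgebra.re hab
      simpa [re_unit hI, re_unit hJ] using this
    -- A nonreal point lies on only one slice, so `I` is a real multiple of `J`.
    have hI' : I = J * ((b * z.im⁻¹ : ℝ) : ℍ[ℝ]) := by
      rw [hre, add_right_inj] at hab
      rw [Quaternion.coe_mul, ← mul_assoc, ← hab, mul_assoc, ← Quaternion.coe_mul,
        mul_inv_cancel₀ h0, Quaternion.coe_one, mul_one]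
    refine ⟨(F z).1.re, b * z.im⁻¹ * (F z).2.re, ?_⟩
    rw [e1, e2, hI', mul_assoc, ← Quaternion.coe_mul]
    simp

/-- The values `F₁ ± J F₂` lie in `ℂ_J`, hence so do `F₁` and `F₂`. Taking `J = i` and `J = j` puts
both in `ℂ_i ∩ ℂ_j = ℝ`. -/
theorem imL_of_isSlicePreservingOn {F : ℂ → HC} {f : ℍ[ℝ] → ℍ[ℝ]} {D : Set ℂ}
    (hF : Induces F f D) (hp : IsSlicePreservingOn f D) :
    ∀ z ∈ D, imL (F z) = 0 := by
  intro z hz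
  have key : ∀ J ∈ unitSphere, (∃ a b : ℝ, (F z).1 + J * (F z).2 = a + J * b) ∧
      ∃ a b : ℝ, (F z).1 - J * (F z).2 = a + J * b := by
    intro J hJ
    refine ⟨?_, ?_⟩
    · rw [← hF z hz J hJ]
      exact hp J hJ _ ⟨mem_circ hz hJ, z.re, z.im, rfl⟩
    · rw [sub_eq_add_neg, ← neg_mul, ← hF z hz _ (neg_unit hJ)]
      exact hp J hJ _ ⟨mem_circ hz (neg_unit hJ), z.re, -z.im, by simp⟩
  obtain ⟨⟨a, b, h1⟩, c, d, h2⟩ := key _ unitI_mem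
  obtain ⟨⟨a', b', h3⟩, c', d', h4⟩ := key _ unitJ_mem
  simp [Quaternion.ext_iff, unitI_coords, unitJ_coords] at h1 h2 h3 h4
  rw [imL_apply, Prod.mk_eq_zero, Quaternion.ext_iff, Quaternion.ext_iff]
  simp only [Quaternion.re_im, Quaternion.imI_im, Quaternion.imJ_im, Quaternion.imK_im,
    Quaternion.re_zero, Quaternion.imI_zero, Quaternion.imJ_zero, Quaternion.imK_zero, true_and]
  refine ⟨⟨?_, ?_, ?_⟩, ?_, ?_, ?_⟩ <;> linarith

/-- The stem function of a `C²` slice function is `C²`. -/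
theorem Induces.contDiffAt {F : ℂ → HC} {f : ℍ[ℝ] → ℍ[ℝ]} {D : Set ℂ} (hD : IsOpen D)
    (hF : Induces F f D) (hf : ContDiffOn ℝ 2 f (circ D)) {z : ℂ} (hz : z ∈ D) :
    ContDiffAt ℝ 2 F z := by
  let emb : ℍ[ℝ] → ℂ →L[ℝ] ℍ[ℝ] := fun J => LinearMap.toContinuousLinearMap
    { toFun := fun w : ℂ => (w.re : ℍ[ℝ]) + J * (w.im : ℍ[ℝ])
      map_add' := fun v w => by simp [mul_add]; abel
      map_smul' := fun r w => by ext <;> simp <;> ring }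
  have hemb : ∀ J w, emb J w = (w.re : ℍ[ℝ]) + J * (w.im : ℍ[ℝ]) := fun _ _ => rfl
  have hcomp : ∀ J ∈ unitSphere, ContDiffOn ℝ 2 (fun w => f (emb J w)) D := fun J hJ =>
    hf.comp (emb J).contDiff.contDiffOn fun w hw => mem_circ hw hJ
  have hp := hcomp _ unitI_mem
  have hm := hcomp _ (neg_unit unitI_mem)
  -- This inverts `f (α ± I β) = F₁ ± I F₂` for `I = i`, expressing `F` through `f` composed with
  -- two linear embeddings of `D`.
  have h1 : ContDiffOn ℝ 2 (fun w => (((1 / 2 : ℝ) • (f (emb unitI w) + f (emb (-unitI) w)),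
      -unitI * ((1 / 2 : ℝ) • (f (emb unitI w) - f (emb (-unitI) w)))) : HC)) D :=
    ((hp.add hm).const_smul (1 / 2 : ℝ)).prodMk
      (contDiffOn_const.mul ((hp.sub hm).const_smul (1 / 2 : ℝ)))
  refine (h1.congr fun w hw => ?_).contDiffAt (hD.mem_nhds hz)
  rw [hemb, hemb, hF w hw _ unitI_mem, hF w hw _ (neg_unit unitI_mem)]
  refine Prod.ext ?_ ?_
  · simp only [neg_mul]
    module
  · have : (1 / 2 : ℝ) • ((F w).1 + unitI * (F w).2 - ((F w).1 + -unitI * (F w).2)) =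
        unitI * (F w).2 := by
      simp only [neg_mul]
      module
    change (F w).2 = -unitI * ((1 / 2 : ℝ) • _)
    rw [this, ← mul_assoc, neg_mul, sq_unit unitI_mem, neg_neg, one_mul]

end SliceFun

end

namespace SliceFun

/-! ### Decomposition of stem functions with vanishing Laplacian -/

theorem IsStemOn.sub {F G : ℂ → HC} {D : Set ℂ} (hF : IsStemOn F D) (hG : IsStemOn G D) :
    IsStemOn (fun z => F z - G z) D := fun z hz => by
  change F _ - G _ = conjL (F z - G z)
  rw [hF z hz, hG z hz, map_sub]
  rfl

theorem IsStemOn.imL {F : ℂ → HC} {D : Set ℂ} (hF : IsStemOn F D) :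
    IsStemOn (fun z => SliceFun.imL (F z)) D := fun z hz => by
  change SliceFun.imL (F _) = SliceFun.conjHC (SliceFun.imL (F z))
  rw [hF z hz, imL_conjHC]

theorem dz_imL_eq_zero {F : ℂ → HC} {D : Set ℂ} (hD : IsOpen D)
    (hd : ∀ z ∈ D, DifferentiableAt ℝ F z) (him : ∀ z ∈ D, imL (F z) = 0) :
    ∀ z ∈ D, imL (dz F z) = 0 ∧ imL (dzbar F z) = 0 := by
  intro z hz
  have h : (fun w => imL (F w)) =ᶠ[𝓝 z] fun _ => 0 := by
    filter_upwards [hD.mem_nhds hz] with w hw using him w hw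
  rw [← (dz_imL (hd z hz)).1, ← (dz_imL (hd z hz)).2, (dz_congr h).1, (dz_congr h).2]
  exact dz_zero z

theorem exists_antiHolomorphic_part {F : ℂ → HC} {D : Set ℂ} (hD : IsOpen D)
    (hDsc : IsSimplyConnected D) (hs : IsSymmetric D) (hF : IsStemOn F D)
    (hC : ∀ z ∈ D, ContDiffAt ℝ 2 F z) (hlap : ∀ z ∈ D, dz (dzbar F) z = 0) :
    ∃ K : ℂ → HC, IsStemOn K D ∧ AntiHolomorphicOn K D ∧ (∀ z ∈ D, dzbar K z = dzbar F z) ∧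
      ((∀ z ∈ D, imL (F z) = 0) → ∀ z ∈ D, imL (K z) = 0) := by
  have hd : ∀ z ∈ D, DifferentiableAt ℝ F z := fun z hz => (hC z hz).differentiableAt (by simp)
  have hanti : AntiHolomorphicOn (dzbar F) D := ⟨fun z hz => (hasFDerivAt_dz (hC z hz)).2.1, hlap⟩
  obtain ⟨K, hK, hKa, hKd⟩ := hanti.exists_stem_primitive hD hDsc hs (dz_stem hD hs hF hd).2
  by_cases him : ∀ z ∈ D, imL (F z) = 0
  · have hKi : ∀ z ∈ D, DifferentiableAt ℝ (fun w => imL (K w)) z := fun z hz =>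
      differentiableAt_imL (hKa.1 z hz)
    -- For real `F`, `∂̄(imL K) = imL (∂̄F) = 0`, so removing `imL K` keeps `∂̄K` and makes `K`
    -- real.
    refine ⟨fun z => K z - imL (K z), hK.sub hK.imL,
      ⟨fun z hz => (hKa.1 z hz).sub (hKi z hz), fun z hz => ?_⟩, fun z hz => ?_, fun _ z hz => ?_⟩
    · rw [(dz_sub (hKa.1 z hz) (hKi z hz)).1, (dz_imL (hKa.1 z hz)).1, hKa.2 z hz]
      simp
    · rw [(dz_sub (hKa.1 z hz) (hKi z hz)).2, (dz_imL (hKa.1 z hz)).2, hKd z hz,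
        (dz_imL_eq_zero hD hd him z hz).2, sub_zero]
    · rw [map_sub, imL_imL, sub_self]
  · exact ⟨K, hK, hKa, hKd, fun h => absurd h him⟩

/-- A `C²` stem function with vanishing Laplacian on a simply connected domain is the sum of a
holomorphic and an anti-holomorphic stem function; if it takes values in `ℝ ⊗ ℂ`, so do the
summands. -/
theorem exists_holomorphic_add_antiHolomorphic {F : ℂ → HC} {D : Set ℂ} (hD : IsOpen D)
    (hDsc : IsSimplyConnected D) (hs : IsSymmetric D) (hF : IsStemOn F D)
    (hC : ∀ z ∈ D, ContDiffAt ℝ 2 F z) (hlap : ∀ z ∈ D, dz (dzbar F) z = 0) :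
    ∃ G K : ℂ → HC, IsStemOn G D ∧ IsStemOn K D ∧ HolomorphicOn G D ∧ AntiHolomorphicOn K D ∧
      (∀ z, F z = G z + K z) ∧
      ((∀ z ∈ D, imL (F z) = 0) → ∀ z ∈ D, imL (G z) = 0 ∧ imL (K z) = 0) := by
  obtain ⟨K, hK, hKa, hKd, hKi⟩ := exists_antiHolomorphic_part hD hDsc hs hF hC hlap
  have hd : ∀ z ∈ D, DifferentiableAt ℝ F z := fun z hz => (hC z hz).differentiableAt (by simp)
  refine ⟨fun z => F z - K z, K, hF.sub hK, hK,
    ⟨fun z hz => (hd z hz).sub (hKa.1 z hz), fun z hz => ?_⟩, hKa, fun z => by simp,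
    fun him z hz => ⟨?_, hKi him z hz⟩⟩
  · rw [(dz_sub (hd z hz) (hKa.1 z hz)).2, hKd z hz, sub_self]
  · rw [map_sub, him z hz, hKi him z hz, sub_zero]

/-- A stem function with vanishing Laplacian whose derivatives are real on the real axis and which
is real at one real point takes values in `ℝ ⊗ ℂ`. -/
theorem imL_eq_zero_of_derivatives {F : ℂ → HC} {D : Set ℂ} (hD : IsOpen D)
    (hconn : IsConnected D) (hC : ∀ z ∈ D, ContDiffAt ℝ 2 F z)
    (hlap : ∀ z ∈ D, dz (dzbar F) z = 0) {p : ℝ} (hp : (p : ℂ) ∈ D) (hFp : imL (F p) = 0)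
    (hdz : ∀ x : ℝ, (x : ℂ) ∈ D → imL (dz F x) = 0)
    (hdzbar : ∀ x : ℝ, (x : ℂ) ∈ D → imL (dzbar F x) = 0) : ∀ z ∈ D, imL (F z) = 0 := by
  have hd : ∀ z ∈ D, DifferentiableAt ℝ F z := fun z hz => (hC z hz).differentiableAt (by simp)
  have h1 : ∀ z ∈ D, imL (dz F z) = 0 :=
    HolomorphicOn.imL_eq_zero hD hconn ⟨fun z hz => (hasFDerivAt_dz (hC z hz)).1, fun z hz => by
      rw [← dz_dzbar_comm (hC z hz), hlap z hz]⟩ hp hdz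
  have hanti : AntiHolomorphicOn (dzbar F) D := ⟨fun z hz => (hasFDerivAt_dz (hC z hz)).2.1, hlap⟩
  have h2 : ∀ z ∈ D, imL (dzbar F z) = 0 := by
    intro z hz
    have := HolomorphicOn.imL_eq_zero hD hconn (antiHolomorphicOn_iff_conjHC.1 hanti) hp
      (fun x hx => by rw [imL_conjHC, hdzbar x hx, conjHC_zero]) z hz
    rw [← conjHC_conjHC (dzbar F z), imL_conjHC, this, conjHC_zero]
  -- Both Wirtinger derivatives of `imL F` vanish, hence so does its full derivative; `imL F` is
  -- then constant on the connected `D`.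
  have h3 : ∀ z ∈ D, fderiv ℝ (fun w => imL (F w)) z = 0 := by
    intro z hz
    have e1 := fderiv_one_eq (fun w => imL (F w)) z
    have e2 := fderiv_I_eq (fun w => imL (F w)) z
    rw [(dz_imL (hd z hz)).1, (dz_imL (hd z hz)).2, h1 z hz, h2 z hz] at e1 e2
    ext v : 1
    have hv : v = v.re • (1 : ℂ) + v.im • Complex.I := by simp
    rw [hv, map_add, map_smul, map_smul, e1, e2]
    simp [iotaMul]
  intro z hz
  rw [← hFp]
  exact hD.is_const_of_fderiv_eq_zero hconn.isPreconnected
    (fun w hw => (differentiableAt_imL (hd w hw)).differentiableWithinAt)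
    (fun w hw => h3 w hw) hz hp

/-- The derivative along the real axis of a function with values in `ℝ ⊗ ℂ` on the real axis. -/
theorem imL_fderiv_one {F : ℂ → HC} {D : Set ℂ} (hD : IsOpen D) {x : ℝ} (hx : (x : ℂ) ∈ D)
    (hd : DifferentiableAt ℝ F x) (him : ∀ t : ℝ, (t : ℂ) ∈ D → imL (F t) = 0) :
    imL (dz F x) + imL (dzbar F x) = 0 := by
  -- `∂ + ∂̄` is the derivative along the real axis, where `imL F` is zero.
  rw [← map_add, ← fderiv_one_eq]
  have h1 : HasDerivAt (fun t : ℝ => imL (F (x + t • (1 : ℂ)))) (imL (fderiv ℝ F x 1)) 0 :=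
    imL.hasFDerivAt.comp_hasDerivAt (0 : ℝ) (hd.hasFDerivAt.hasLineDerivAt 1)
  have hc : Continuous (fun t : ℝ => (x : ℂ) + t • (1 : ℂ)) := by fun_prop
  have h2 : (fun t : ℝ => imL (F (x + t • (1 : ℂ)))) =ᶠ[𝓝 0] fun _ => 0 := by
    have : ∀ᶠ t : ℝ in 𝓝 0, (x : ℂ) + t • (1 : ℂ) ∈ D :=
      hc.continuousAt.eventually_mem (hD.mem_nhds (by simpa using hx))
    filter_upwards [this] with t ht
    have e : (x : ℂ) + t • (1 : ℂ) = ((x + t : ℝ) : ℂ) := by simp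
    rw [e] at ht ⊢
    exact him _ ht
  exact h1.unique ((hasDerivAt_const (0 : ℝ) (0 : HC)).congr_of_eventuallyEq h2)

/-- `∂_* ∂̄_* f` is induced by `∂∂̄F`, stem functions are unique, and the factor `4` is invertible
in `ℍ`. -/
theorem lapStar_eq_zero_iff {F : ℂ → HC} {f : ℍ[ℝ] → ℍ[ℝ]} {D : Set ℂ} (hD : IsOpen D)
    (hs : IsSymmetric D) (hF : IsStemOn F D) (hi : Induces F f D)
    (hC : ∀ z ∈ D, ContDiffAt ℝ 2 F z) :
    (∀ q ∈ circ D, lapStar f q = 0) ↔ ∀ z ∈ D, dz (dzbar F) z = 0 := by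
  have hd : ∀ z ∈ D, DifferentiableAt ℝ F z := fun z hz => (hC z hz).differentiableAt (by simp)
  have hind : Induces (dz (dzbar F)) (dStar (dbarStar f)) D :=
    dStar_eq hD hs (dz_stem hD hs hF hd).2 (dbarStar_eq hD hs hF hi hd)
      fun z hz => (hasFDerivAt_dz (hC z hz)).2.1
  have h0 : Induces (fun _ => 0) (fun _ => 0) D := fun z _ I _ => by simp
  have four_ne : (4 : ℍ[ℝ]) ≠ 0 := fun h => by
    have h' : (4 : ℝ) = 0 := congrArg QuaternionAlgebra.re h
    norm_num at h'
  have hlap : ∀ q, lapStar f q = 0 ↔ dStar (dbarStar f) q = 0 := fun q =>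
    mul_eq_zero.trans (or_iff_right four_ne)
  simp only [hlap]
  exact ⟨fun h z hz => hind.eqOn h0 h hz, fun h => hind.eq_of_eqOn h0 h⟩

end SliceFun

/-! ### The main theorem, read off from the stem function. -/

theorem theorem8 (D : Set ℂ) (hDsymm : IsSymmetric D) (hDopen : IsOpen D)
    (hDconn : IsConnected D) (hDreal : ∃ x : ℝ, (x : ℂ) ∈ D)
    (hDsc : IsSimplyConnected D)
    (f : ℍ[ℝ] → ℍ[ℝ]) (hf : IsSliceOn f D) (hf2 : ContDiffOn ℝ 2 f (circ D)) :
    ((∀ q ∈ circ D, lapStar f q = 0) ↔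
      ∃ g h : ℍ[ℝ] → ℍ[ℝ], IsRegularOn g D ∧ IsAntiRegularOn h D ∧
        ∀ q ∈ circ D, f q = g q + h q) ∧
    ((∀ q ∈ circ D, lapStar f q = 0) →
      List.TFAE [
        ∃ g h : ℍ[ℝ] → ℍ[ℝ], (IsRegularOn g D ∧ IsSlicePreservingOn g D) ∧
          (IsAntiRegularOn h D ∧ IsSlicePreservingOn h D) ∧ ∀ q ∈ circ D, f q = g q + h q,
        (∀ x : ℝ, (x : ℂ) ∈ D → (f x).im = 0) ∧
          (∀ x : ℝ, (x : ℂ) ∈ D → (dStar f x).im = 0),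
        (∀ x : ℝ, (x : ℂ) ∈ D → (f x).im = 0) ∧
          (∀ x : ℝ, (x : ℂ) ∈ D → (dbarStar f x).im = 0),
        (∃ p : ℝ, (p : ℂ) ∈ D ∧ (f p).im = 0) ∧
          (∀ x : ℝ, (x : ℂ) ∈ D → (dbarStar f x).im = 0) ∧
          (∀ x : ℝ, (x : ℂ) ∈ D → (dStar f x).im = 0)]) := by
  obtain ⟨F, hF, hi⟩ := hf
  have hC : ∀ z ∈ D, ContDiffAt ℝ 2 F z := fun z hz => hi.contDiffAt hDopen hf2 hz
  have hd : ∀ z ∈ D, DifferentiableAt ℝ F z := fun z hz => (hC z hz).differentiableAt (by simp)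
  have hlapiff := lapStar_eq_zero_iff hDopen hDsymm hF hi hC
  have hstem := dz_stem hDopen hDsymm hF hd
  have hidz := dStar_eq hDopen hDsymm hF hi hd
  have hidzbar := dbarStar_eq hDopen hDsymm hF hi hd
  have rF : ∀ x : ℝ, (x : ℂ) ∈ D → ((f x).im = 0 ↔ imL (F x) = 0) := fun x hx =>
    hi.im_apply_real_eq_zero_iff hF hx
  have rdz : ∀ x : ℝ, (x : ℂ) ∈ D → ((dStar f x).im = 0 ↔ imL (dz F x) = 0) := fun x hx =>
    hidz.im_apply_real_eq_zero_iff hstem.1 hx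
  have rdzbar : ∀ x : ℝ, (x : ℂ) ∈ D → ((dbarStar f x).im = 0 ↔ imL (dzbar F x) = 0) :=
    fun x hx => hidzbar.im_apply_real_eq_zero_iff hstem.2 hx
  refine ⟨⟨fun hlap => ?_, ?_⟩, fun hlap => ?_⟩
  · obtain ⟨G, K, hG, hK, hGh, hKa, hadd, -⟩ :=
      exists_holomorphic_add_antiHolomorphic hDopen hDsc hDsymm hF hC (hlapiff.1 hlap)
    obtain ⟨g, hg⟩ := hG.exists_induces hDsymm
    obtain ⟨h, hh⟩ := hK.exists_induces hDsymm
    exact ⟨g, h, ⟨G, hG, hg, hGh⟩, ⟨K, hK, hh, hKa⟩,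
      hi.eq_of_eqOn (hg.add hh) fun z _ => hadd z⟩
  · rintro ⟨g, h, ⟨G, hG, hg, hGh⟩, ⟨K, hK, hh, hKa⟩, hadd⟩
    rw [hlapiff]
    have hFGK : ∀ z ∈ D, F z = G z + K z := fun z hz => hi.eqOn (hg.add hh) hadd hz
    intro z hz
    -- Equality near `z`, and not only at `z`, is needed because `dz` is applied to it next.
    have e : dzbar F =ᶠ[𝓝 z] dzbar K := by
      filter_upwards [hDopen.mem_nhds hz] with w hw
      have : F =ᶠ[𝓝 w] fun u => G u + K u := by
        filter_upwards [hDopen.mem_nhds hw] with u hu using hFGK u hu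
      rw [(dz_congr this).2, (dz_add (hGh.1 w hw) (hKa.1 w hw)).2, hGh.2 w hw, zero_add]
    rw [(dz_congr e).1, hKa.dz_dzbar_eq_zero hDopen hz]
  · have hlap' := hlapiff.1 hlap
    have real_of_a : (∃ g h : ℍ[ℝ] → ℍ[ℝ], (IsRegularOn g D ∧ IsSlicePreservingOn g D) ∧
        (IsAntiRegularOn h D ∧ IsSlicePreservingOn h D) ∧ ∀ q ∈ circ D, f q = g q + h q) →
        ∀ z ∈ D, imL (F z) = 0 := by
      rintro ⟨g, h, ⟨⟨G, -, hg, -⟩, hgp⟩, ⟨⟨K, -, hh, -⟩, hhp⟩, hadd⟩ z hz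
      rw [hi.eqOn (hg.add hh) hadd hz, map_add, imL_of_isSlicePreservingOn hg hgp z hz,
        imL_of_isSlicePreservingOn hh hhp z hz, add_zero]
    tfae_have 1 → 2 := fun ha => by
      have h := real_of_a ha
      exact ⟨fun x hx => (rF x hx).2 (h x hx),
        fun x hx => (rdz x hx).2 (dz_imL_eq_zero hDopen hd h x hx).1⟩
    tfae_have 2 → 3 := fun ⟨h1, h2⟩ => ⟨h1, fun x hx => by
      have := imL_fderiv_one hDopen hx (hd x hx) fun t ht => (rF t ht).1 (h1 t ht)
      rwa [(rdz x hx).1 (h2 x hx), zero_add, ← rdzbar x hx] at this⟩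
    tfae_have 3 → 4 := fun ⟨h1, h2⟩ => by
      obtain ⟨p, hp⟩ := hDreal
      refine ⟨⟨p, hp, h1 p hp⟩, h2, fun x hx => ?_⟩
      have := imL_fderiv_one hDopen hx (hd x hx) fun t ht => (rF t ht).1 (h1 t ht)
      rwa [(rdzbar x hx).1 (h2 x hx), add_zero, ← rdz x hx] at this
    tfae_have 4 → 1 := fun ⟨⟨p, hp, h0⟩, h1, h2⟩ => by
      have him := imL_eq_zero_of_derivatives hDopen hDconn hC hlap' hp ((rF p hp).1 h0)
        (fun x hx => (rdz x hx).1 (h2 x hx)) fun x hx => (rdzbar x hx).1 (h1 x hx)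
      obtain ⟨G, K, hG, hK, hGh, hKa, hadd, hGK⟩ :=
        exists_holomorphic_add_antiHolomorphic hDopen hDsc hDsymm hF hC hlap'
      obtain ⟨g, hg⟩ := hG.exists_induces hDsymm
      obtain ⟨h, hh⟩ := hK.exists_induces hDsymm
      exact ⟨g, h,
        ⟨⟨G, hG, hg, hGh⟩, isSlicePreservingOn_of_imL hG hg fun z hz => (hGK him z hz).1⟩,
        ⟨⟨K, hK, hh, hKa⟩, isSlicePreservingOn_of_imL hK hh fun z hz => (hGK him z hz).2⟩,
        hi.eq_of_eqOn (hg.add hh) fun z _ => hadd z⟩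
    tfae_finish
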